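/- An election consists of a finite set of $m\ge 1$ candidates and a finite list of votes, each vote being a strict linear order on the candidates. An election system assigns to each election a set of winners. A scoring vector is $\alpha=(\alpha_1,\dots,\alpha_m)$ with $\alpha_1\ge\dots\ge\alpha_m$; under it each voter gives $\alpha_i$ points to his or her $i$th most preferred candidate, and the winners are the candidates whose total score is highest. Let $T\subseteq\mathbb{Q}$. A pure $T$-generator is a function $f$ that maps each string $0^m$, $m\ge1$, to a scoring vector $\alpha^m$ of length $m$ with all coefficients in $T$, such that for each $m\ge2$ some component of $\alpha^m$ can be deleted so that exactly $\alpha^{m-1}$ remains. It generates the election system whose winners in each $m$-candidate election, $m\ge1$, are the winners under $\alpha^m$. Let $\textbf{nonuniform-}T\textbf{-PSR}$ be the class of election systems generated by some (possibly uncomputable) pure $T$-generator, and let $T\textbf{-PSR}$ (FP-uniform) be the class of those generated by some pure $T$-generator that is computable in deterministic time polynomial in $m$ (with rationals written as fractions in binary). **Theorem.** 1. $\mathbb{Q}_{\ge0}\textbf{-PSR}\not\subseteq\textbf{nonuniform-}\mathbb{Z}\textbf{-PSR}$; 2. $\mathbb{Z}\textbf{-PSR}\not\subseteq\textbf{nonuniform-}\mathbb{Q}_{\ge0}\textbf{-PSR}$;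 3. $\mathbb{Q}\textbf{-PSR}\not\subseteq\textbf{nonuniform-}\mathbb{Q}_{\ge0}\textbf{-PSR}\,\cup\,\textbf{nonuniform-}\mathbb{Z}\textbf{-PSR}$. -/

import Mathlib

/-- The votes of an election over `m` named candidates: a vote is a strict linear order, given by
the bijection that sends each candidate to its position (position `0` is the most preferred). -/
structure Election where
  /-- the number of candidates -/
  numCands : ℕ
  numCands_pos : 1 ≤ numCands
  /-- the candidates -/
  Cand : Type
  card_cand : Nat.card Cand = numCands
  /-- the votes, one per voter -/
  votes : List (Cand ≃ Fin numCands)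

/-- An election system selects, in every election, a set of winners. -/
def ElectionSystem : Type 1 := (e : Election) → Set e.Cand

/-- The score of candidate `c` under the scoring vector `α`. -/
def Election.score (e : Election) (α : Fin e.numCands → ℚ) (c : e.Cand) : ℚ :=
  (e.votes.map fun v => α (v c)).sum

/-- The winners under the scoring vector `α`: the candidates of highest score. -/
def Election.scoringWinners (e : Election) (α : Fin e.numCands → ℚ) : Set e.Cand :=
  {c | ∀ d : e.Cand, e.score α d ≤ e.score α c}

/-- A candidate for a generator: for every `m` an `m`-component vector. The (empty) vector at
`m = 0` plays no role. -/
abbrev VectorFamily : Type := (m : ℕ) → Fin m → ℚ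

namespace VectorFamily

/-- All vectors with at least one component are nonincreasing with coefficients in `T`. -/
def IsScoring (T : Set ℚ) (f : VectorFamily) : Prop :=
  ∀ m : ℕ, 1 ≤ m → Antitone (f m) ∧ ∀ i : Fin m, f m i ∈ T

/-- Purity: for `m ≥ 2`, deleting some component of the vector of length `m` leaves exactly the
vector of length `m - 1`. -/
def IsPure (f : VectorFamily) : Prop :=
  ∀ m : ℕ, 1 ≤ m → ∃ i : Fin (m + 1), ∀ j : Fin m, f (m + 1) (i.succAbove j) = f m j

/-- `f` generates the election system `E`. -/
def Generates (f : VectorFamily) (E : ElectionSystem) : Prop :=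
  ∀ e : Election, E e = e.scoringWinners (f e.numCands)

end VectorFamily

/-- The output alphabet for vectors of rationals. -/
inductive VecSymbol where
  | bit (b : Bool)
  | minus
  | slash
  | comma
  deriving DecidableEq, Fintype

/-- A natural number in binary, least significant bit first (`0` is the empty word). -/
def encodeNatBits (n : ℕ) : List VecSymbol := n.bits.map VecSymbol.bit

/-- A rational number: an optional minus sign, the absolute value of the numerator, a slash and
the denominator, for the fraction in lowest terms. -/
def encodeRat (q : ℚ) : List VecSymbol :=
  (if q < 0 then [VecSymbol.minus] else []) ++
    (encodeNatBits q.num.natAbs ++ VecSymbol.slash :: encodeNatBits q.den)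

/-- A vector: its components, each followed by a comma. -/
def encodeRatList (l : List ℚ) : List VecSymbol :=
  l.flatMap fun q => encodeRat q ++ [VecSymbol.comma]

/-- `f` is a polynomial-time function: there is a Turing machine that on input `0ᵐ` outputs the
vector `f m` within a number of steps that is polynomial in the input length `m`. -/
def VectorFamily.IsFP (f : VectorFamily) : Prop :=
  Nonempty (Turing.TM2ComputableInPolyTime Computability.unaryEncodeNat encodeRatList
    fun m : ℕ => List.ofFn (f m))

/-- The nonuniform pure scoring rules with coefficients in `T`. -/
def nonuniformPSR (T : Set ℚ) : Set ElectionSystem :=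
  {E | ∃ f : VectorFamily, f.IsScoring T ∧ f.IsPure ∧ f.Generates E}

/-- The FP-uniform pure scoring rules with coefficients in `T`. -/
def uniformPSR (T : Set ℚ) : Set ElectionSystem :=
  {E | ∃ f : VectorFamily, f.IsFP ∧ f.IsScoring T ∧ f.IsPure ∧ f.Generates E}

/-- The integers as a coefficient set. -/
def intCoeffs : Set ℚ := Set.range ((↑) : ℤ → ℚ)

/-- The nonnegative rationals as a coefficient set. -/
def nonnegRatCoeffs : Set ℚ := {q | 0 ≤ q}

/-- The rationals as a coefficient set. -/
def ratCoeffs : Set ℚ := Set.univ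

/-! The encoding of vectors is injective. -/

theorem encodeNatBits_injective : Function.Injective encodeNatBits := by
  intro a b h
  have h1 : a.bits = b.bits :=
    List.map_injective_iff.2 (fun x y hxy => by injection hxy) h
  apply Nat.digits.injective 2
  rw [Nat.digits_two_eq_bits, Nat.digits_two_eq_bits, h1]

theorem append_cons_cancel {α : Type*} {s : α} :
    ∀ {a a' b b' : List α}, s ∉ a → s ∉ a' → a ++ s :: b = a' ++ s :: b' → a = a' ∧ b = b'
  | [], [], _, _, _, _, h => by simpa using h
  | [], _ :: _, _, _, _, h', h => by simp at h h'; exact absurd h.1 h'.1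
  | _ :: _, [], _, _, h', _, h => by simp at h h'; exact absurd h.1.symm h'.1
  | x :: a, y :: a', b, b', h1, h2, h => by
    simp only [List.mem_cons, not_or, List.cons_append, List.cons.injEq] at h1 h2 h
    obtain ⟨h3, h4⟩ := append_cons_cancel h1.2 h2.2 h.2
    exact ⟨by rw [h.1, h3], h4⟩

theorem encodeRat_injective : Function.Injective encodeRat := by
  intro p q h
  unfold encodeRat at h
  rw [← List.append_assoc, ← List.append_assoc] at h
  obtain ⟨h1, h2⟩ := append_cons_cancel
    (by split_ifs <;> simp [encodeNatBits]) (by split_ifs <;> simp [encodeNatBits]) h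
  have hd := encodeNatBits_injective h2
  have key : ∀ (n : ℕ) (l : List VecSymbol), encodeNatBits n ≠ VecSymbol.minus :: l := by
    intro n l hl
    have : VecSymbol.minus ∈ encodeNatBits n := by rw [hl]; simp
    simp [encodeNatBits] at this
  apply Rat.ext _ hd
  by_cases hp : p < 0 <;> by_cases hq : q < 0 <;> simp only [hp, hq, if_true, if_false] at h1
  · have := encodeNatBits_injective (List.append_cancel_left h1)
    have := Rat.num_neg.2 hp
    have := Rat.num_neg.2 hq
    omega
  · exact absurd h1.symm (key _ _)
  · exact absurd h1 (key _ _)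
  · have := encodeNatBits_injective (List.append_cancel_left h1)
    have := Rat.num_nonneg.2 (not_lt.1 hp)
    have := Rat.num_nonneg.2 (not_lt.1 hq)
    omega

theorem encodeRatList_injective : Function.Injective encodeRatList := by
  have hc : ∀ q : ℚ, VecSymbol.comma ∉ encodeRat q := by
    intro q
    unfold encodeRat
    split_ifs <;> simp [encodeNatBits]
  intro l
  induction l with
  | nil => intro l' h; cases l' <;> simp [encodeRatList] at h ⊢
  | cons q l ih =>
    intro l' h
    cases l' with
    | nil => simp [encodeRatList] at h
    | cons q' l' =>
      simp only [encodeRatList, List.flatMap_cons, List.append_assoc, List.singleton_append] at h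
      obtain ⟨h1, h2⟩ := append_cons_cancel (hc q) (hc q') h
      rw [encodeRat_injective h1, ih h2]

/-! ### Binary encodings -/

/-! Each separation uses a strictly decreasing sequence `c` and the system whose vectors are its
initial segments; deleting the last component makes this generator pure. Two facts make the
generator rigid. First, a vector with the same winners in all elections as a strictly decreasing one
is a positive affine image of it (`SameWinners.exists_affine`). Second, if the first gaps of `c`
avoid two coincidences, a pure generator of the same system can never delete component 0 or 1, so
the affine map does not depend on the length (`VectorFamily.exists_affine_of_generates`). Hence
coefficients in `T` force `a * c k + b ∈ T` for all `k`, with fixed `a > 0` and `b`.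

No such image is nonnegative if `c` tends to `-∞`, and none is integral if integer combinations of
its gaps include a fixed positive multiple of `a / 2 ^ k` for every `k`. The sequences 2·2⁻ᵏ + 4⁻ᵏ,
-(2ᵏ + 2·4ᵏ) and -(2⁻ᵏ + 2·2ᵏ) have the first, second and both kinds of obstruction needed. Each
mixes two exponentials because the segments of a single geometric sequence could, after rescaling,
also be extended at the front. Their binary encodings share one shape, so a single machine scheme
proves polynomial time. -/

theorem Nat.bits_two_pow_mul (i : ℕ) {n : ℕ} (hn : n ≠ 0) :
    (2 ^ i * n).bits = List.replicate i false ++ n.bits := by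
  induction i with
  | zero => simp
  | succ i ih =>
    rw [pow_succ', mul_assoc, Nat.bit0_bits _ (by positivity), ih]
    rfl

theorem encodeRat_natCast_div {n d : ℕ} (hd : d ≠ 0) (h : n.Coprime d) :
    encodeRat ((n : ℚ) / d) = encodeNatBits n ++ VecSymbol.slash :: encodeNatBits d := by
  have hd' : (0 : ℤ) < d := by exact_mod_cast Nat.pos_of_ne_zero hd
  have hnum := Rat.num_div_eq_of_coprime (a := n) hd' (by simpa using h)
  have hden := Rat.den_div_eq_of_coprime (a := n) hd' (by simpa using h)
  simp only [Int.cast_natCast] at hnum hden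
  have hneg : ¬ ((n : ℚ) / d < 0) := not_lt.2 (by positivity)
  rw [encodeRat, if_neg hneg, hnum, Int.natAbs_natCast, Int.natCast_inj.1 hden]
  rfl

theorem encodeRat_neg_natCast_div {n d : ℕ} (hn : n ≠ 0) (hd : d ≠ 0) (h : n.Coprime d) :
    encodeRat (-((n : ℚ) / d)) =
      VecSymbol.minus :: (encodeNatBits n ++ VecSymbol.slash :: encodeNatBits d) := by
  have hpos : 0 < (n : ℚ) / d := by positivity
  rw [← encodeRat_natCast_div hd h, encodeRat, encodeRat, if_pos (by linarith),
    if_neg (by linarith), Rat.num_neg_eq_neg_num, Rat.den_neg_eq_den, Int.natAbs_neg]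
  rfl

theorem encodeNatBits_two_pow_mul (i : ℕ) {n : ℕ} (hn : n ≠ 0) :
    encodeNatBits (2 ^ i * n) = List.replicate i (VecSymbol.bit false) ++ encodeNatBits n := by
  simp [encodeNatBits, Nat.bits_two_pow_mul i hn]

theorem encodeNatBits_two_pow (k : ℕ) :
    encodeNatBits (2 ^ k) = List.replicate k (VecSymbol.bit false) ++ [VecSymbol.bit true] := by
  rw [← mul_one (2 ^ k), encodeNatBits_two_pow_mul k one_ne_zero]
  simp [encodeNatBits, Nat.one_bits]

theorem encodeNatBits_four_pow (k : ℕ) :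
    encodeNatBits (4 ^ k) =
      (List.replicate k [VecSymbol.bit false, VecSymbol.bit false]).flatten ++
        [VecSymbol.bit true] := by
  rw [show 4 ^ k = 2 ^ (k * 2) by rw [mul_comm, pow_mul]; norm_num, encodeNatBits_two_pow]
  exact congrArg (· ++ _) (List.flatten_replicate_replicate (n := k) (m := 2)).symm

theorem encodeNatBits_two_mul_add_one (n : ℕ) :
    encodeNatBits (2 * n + 1) = VecSymbol.bit true :: encodeNatBits n := by
  simp [encodeNatBits, Nat.bit1_bits]

/-! ### A machine that prints words of a regular shape -/

namespace WordPrinter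

/-- The stacks of the printing machine. -/
inductive Stack
  | input
  | work
  | output
  deriving DecidableEq

instance : Fintype Stack where
  elems := {.input, .work, .output}
  complete x := by cases x <;> decide

/-- The labels of the printing machine. -/
inductive Label
  | next
  | forth
  | back
  deriving DecidableEq

instance : Fintype Label where
  elems := {.next, .forth, .back}
  complete x := by cases x <;> decide

/-- The stack alphabets: tally marks on the first two stacks. -/
abbrev Alphabet : Stack → Type
  | .input => Bool
  | .work => Bool
  | .output => VecSymbol

/-- The statements of the printing machine; the state records whether the last pop succeeded. -/
abbrev Statement : Type := Turing.TM2.Stmt Alphabet Label Bool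

/-- Put a fixed word on top of the output stack, then continue with `q`. -/
def pushWord : List VecSymbol → Statement → Statement
  | [], q => q
  -- The tail is pushed before the head, so the word reads correctly from the top of the stack down.
  | a :: w, q => pushWord w (.push .output (fun _ => a) q)

/-- Remove the top of a stack and go on according to whether there was one. -/
def popBranch (k : Stack) (q₁ q₂ : Statement) : Statement :=
  .pop k (fun _ s => s.isSome) (.branch id q₁ q₂)

variable (pre X mid Y post : List VecSymbol)

/-- Started with `m` tally marks, the machine prints the words `pre Xᵏ mid Yᵏ post` for
`k = m - 1, …, 0`, each one in front of those already printed. -/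
def machine : Turing.FinTM2 where
  K := Stack
  k₀ := .input
  k₁ := .output
  Γ := Alphabet
  Λ := Label
  main := .next
  σ := Bool
  initialState := false
  Γk₀Fin := inferInstanceAs (Fintype Bool)
  m
    | .next => popBranch .input (pushWord post (.goto fun _ => .forth)) .halt
    | .forth => popBranch .input
        (.push .work (fun _ => true) (pushWord Y (.goto fun _ => .forth)))
        (pushWord mid (.goto fun _ => .back))
    | .back => popBranch .work
        (.push .input (fun _ => true) (pushWord X (.goto fun _ => .back)))
        (pushWord pre (.goto fun _ => .next))

/-- The stack contents with `i` and `w` tally marks and printed word `o`. -/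
def contents (i w : ℕ) (o : List VecSymbol) : ∀ k, List (Alphabet k)
  | .input => List.replicate i true
  | .work => List.replicate w true
  | .output => o

theorem update_input (i i' w : ℕ) (o : List VecSymbol) :
    Function.update (contents i w o) .input (List.replicate i' true) = contents i' w o := by
  funext k; cases k <;> rfl

theorem update_work (i w w' : ℕ) (o : List VecSymbol) :
    Function.update (contents i w o) .work (List.replicate w' true) = contents i w' o := by
  funext k; cases k <;> rfl

theorem update_output (i w : ℕ) (o o' : List VecSymbol) :
    Function.update (contents i w o) .output o' = contents i w o' := by
  funext k; cases k <;> rfl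

theorem stepAux_pushWord (u : List VecSymbol) (q : Statement) (v : Bool) (i w : ℕ)
    (o : List VecSymbol) :
    Turing.TM2.stepAux (pushWord u q) v (contents i w o) =
      Turing.TM2.stepAux q v (contents i w (u ++ o)) := by
  induction u generalizing q with
  | nil => rfl
  | cons a u ih =>
    rw [pushWord, ih, Turing.TM2.stepAux.eq_1, update_output]
    rfl

/-- A configuration of the printing machine. -/
def cfg (l : Option Label) (v : Bool) (i w : ℕ) (o : List VecSymbol) :
    (machine pre X mid Y post).Cfg :=
  (⟨l, v, contents i w o⟩ : Turing.TM2.Cfg Alphabet Label Bool)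

theorem stepAux_popBranch_input_zero (q₁ q₂ : Statement) (v : Bool) (w : ℕ) (o : List VecSymbol) :
    Turing.TM2.stepAux (popBranch .input q₁ q₂) v (contents 0 w o) =
      Turing.TM2.stepAux q₂ false (contents 0 w o) := by
  have := update_input 0 0 w o
  -- `eq_3` and `eq_5` are the clauses for pop and branch.
  simp only [popBranch, Turing.TM2.stepAux.eq_3, Turing.TM2.stepAux.eq_5]
  exact congrArg (Turing.TM2.stepAux q₂ false) this

theorem stepAux_popBranch_input_succ (q₁ q₂ : Statement) (v : Bool) (i w : ℕ)
    (o : List VecSymbol) :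
    Turing.TM2.stepAux (popBranch .input q₁ q₂) v (contents (i + 1) w o) =
      Turing.TM2.stepAux q₁ true (contents i w o) := by
  have := update_input (i + 1) i w o
  simp only [popBranch, Turing.TM2.stepAux.eq_3, Turing.TM2.stepAux.eq_5]
  exact congrArg (Turing.TM2.stepAux q₁ true) this

theorem stepAux_popBranch_work_zero (q₁ q₂ : Statement) (v : Bool) (i : ℕ) (o : List VecSymbol) :
    Turing.TM2.stepAux (popBranch .work q₁ q₂) v (contents i 0 o) =
      Turing.TM2.stepAux q₂ false (contents i 0 o) := by
  have := update_work i 0 0 o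
  simp only [popBranch, Turing.TM2.stepAux.eq_3, Turing.TM2.stepAux.eq_5]
  exact congrArg (Turing.TM2.stepAux q₂ false) this

theorem stepAux_popBranch_work_succ (q₁ q₂ : Statement) (v : Bool) (i w : ℕ)
    (o : List VecSymbol) :
    Turing.TM2.stepAux (popBranch .work q₁ q₂) v (contents i (w + 1) o) =
      Turing.TM2.stepAux q₁ true (contents i w o) := by
  have := update_work i (w + 1) w o
  simp only [popBranch, Turing.TM2.stepAux.eq_3, Turing.TM2.stepAux.eq_5]
  exact congrArg (Turing.TM2.stepAux q₁ true) this

theorem step_next_zero (v : Bool) (w : ℕ) (o : List VecSymbol) :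
    (machine pre X mid Y post).step (cfg pre X mid Y post (some .next) v 0 w o) =
      some (cfg pre X mid Y post none false 0 w o) :=
  congrArg some (stepAux_popBranch_input_zero _ _ v w o)

theorem step_next_succ (v : Bool) (i w : ℕ) (o : List VecSymbol) :
    (machine pre X mid Y post).step (cfg pre X mid Y post (some .next) v (i + 1) w o) =
      some (cfg pre X mid Y post (some .forth) true i w (post ++ o)) :=
  congrArg some ((stepAux_popBranch_input_succ _ _ v i w o).trans
    (stepAux_pushWord _ _ _ _ _ _))

theorem step_forth_zero (v : Bool) (w : ℕ) (o : List VecSymbol) :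
    (machine pre X mid Y post).step (cfg pre X mid Y post (some .forth) v 0 w o) =
      some (cfg pre X mid Y post (some .back) false 0 w (mid ++ o)) :=
  congrArg some ((stepAux_popBranch_input_zero _ _ v w o).trans
    (stepAux_pushWord _ _ _ _ _ _))

theorem step_forth_succ (v : Bool) (i w : ℕ) (o : List VecSymbol) :
    (machine pre X mid Y post).step (cfg pre X mid Y post (some .forth) v (i + 1) w o) =
      some (cfg pre X mid Y post (some .forth) true i (w + 1) (Y ++ o)) := by
  refine congrArg some ((stepAux_popBranch_input_succ _ _ v i w o).trans ?_)
  rw [Turing.TM2.stepAux.eq_1]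
  exact (congrArg (Turing.TM2.stepAux _ true) (update_work i w (w + 1) o)).trans
    (stepAux_pushWord _ _ _ _ _ _)

theorem step_back_zero (v : Bool) (i : ℕ) (o : List VecSymbol) :
    (machine pre X mid Y post).step (cfg pre X mid Y post (some .back) v i 0 o) =
      some (cfg pre X mid Y post (some .next) false i 0 (pre ++ o)) :=
  congrArg some ((stepAux_popBranch_work_zero _ _ v i o).trans
    (stepAux_pushWord _ _ _ _ _ _))

theorem step_back_succ (v : Bool) (i w : ℕ) (o : List VecSymbol) :
    (machine pre X mid Y post).step (cfg pre X mid Y post (some .back) v i (w + 1) o) =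
      some (cfg pre X mid Y post (some .back) true (i + 1) w (X ++ o)) := by
  refine congrArg some ((stepAux_popBranch_work_succ _ _ v i w o).trans ?_)
  rw [Turing.TM2.stepAux.eq_1]
  exact (congrArg (Turing.TM2.stepAux _ true) (update_input i (i + 1) w o)).trans
    (stepAux_pushWord _ _ _ _ _ _)

/-- The configuration after `n` steps. -/
def run (n : ℕ) (c : (machine pre X mid Y post).Cfg) : Option (machine pre X mid Y post).Cfg :=
  (flip bind (machine pre X mid Y post).step)^[n] (some c)

theorem run_succ {n : ℕ} {c c' : (machine pre X mid Y post).Cfg}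
    (h : (machine pre X mid Y post).step c = some c') :
    run pre X mid Y post (n + 1) c = run pre X mid Y post n c' := by
  rw [run, Function.iterate_succ_apply]
  exact congrArg _ h

theorem flatten_replicate_succ_append (k : ℕ) (w o : List VecSymbol) :
    (List.replicate (k + 1) w).flatten ++ o = (List.replicate k w).flatten ++ (w ++ o) := by
  rw [List.replicate_succ', List.flatten_append]
  simp

theorem run_forth (n i : ℕ) (v : Bool) (w : ℕ) (o : List VecSymbol) :
    run pre X mid Y post (n + (i + 1)) (cfg pre X mid Y post (some .forth) v i w o) =
      run pre X mid Y post n (cfg pre X mid Y post (some .back) false 0 (w + i)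
        (mid ++ ((List.replicate i Y).flatten ++ o))) := by
  induction i generalizing v w o with
  | zero => exact run_succ _ _ _ _ _ (step_forth_zero _ _ _ _ _ v w o)
  | succ i ih =>
    rw [← add_assoc, run_succ _ _ _ _ _ (step_forth_succ _ _ _ _ _ v i w o), ih,
      flatten_replicate_succ_append, add_right_comm w 1 i, add_assoc w i 1]

theorem run_back (n i : ℕ) (v : Bool) (w : ℕ) (o : List VecSymbol) :
    run pre X mid Y post (n + (w + 1)) (cfg pre X mid Y post (some .back) v i w o) =
      run pre X mid Y post n (cfg pre X mid Y post (some .next) false (i + w) 0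
        (pre ++ ((List.replicate w X).flatten ++ o))) := by
  induction w generalizing v i o with
  | zero => exact run_succ _ _ _ _ _ (step_back_zero _ _ _ _ _ v i o)
  | succ w ih =>
    rw [← add_assoc, run_succ _ _ _ _ _ (step_back_succ _ _ _ _ _ v i w o), ih,
      flatten_replicate_succ_append, add_right_comm i 1 w, add_assoc i w 1]

/-- The word printed in round `k`. -/
def word (k : ℕ) : List VecSymbol :=
  pre ++ (List.replicate k X).flatten ++ mid ++ (List.replicate k Y).flatten ++ post

/-- One step removes a tally mark, `i + 1` steps move the remaining marks to the work stack, and `i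
+ 1` move them back. The round thus restores its counter, decreased by one. -/
theorem run_round (n i : ℕ) (v : Bool) (o : List VecSymbol) :
    run pre X mid Y post (n + (2 * i + 3)) (cfg pre X mid Y post (some .next) v (i + 1) 0 o) =
      run pre X mid Y post n
        (cfg pre X mid Y post (some .next) false i 0 (word pre X mid Y post i ++ o)) := by
  rw [show n + (2 * i + 3) = (n + (i + 1)) + (i + 1) + 1 by ring,
    run_succ _ _ _ _ _ (step_next_succ _ _ _ _ _ v i 0 o), run_forth, zero_add, run_back, zero_add]
  simp [word]

/-- The rounds cost `2 * i + 3` steps for `i < m` and halting costs one: a sum of consecutive odd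
numbers, hence a square. -/
theorem run_all (m : ℕ) (v : Bool) (o : List VecSymbol) :
    run pre X mid Y post ((m + 1) ^ 2) (cfg pre X mid Y post (some .next) v m 0 o) =
      some (cfg pre X mid Y post none false 0 0
        ((List.range m).flatMap (word pre X mid Y post) ++ o)) := by
  induction m generalizing v o with
  | zero => exact run_succ _ _ _ _ _ (step_next_zero _ _ _ _ _ v 0 o)
  | succ m ih =>
    rw [show (m + 1 + 1) ^ 2 = (m + 1) ^ 2 + (2 * m + 3) by ring, run_round, ih,
      List.range_succ, List.flatMap_append]
    simp

theorem unaryEncodeNat_eq_replicate (m : ℕ) :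
    Computability.unaryEncodeNat m = List.replicate m true := by
  induction m with
  | zero => rfl
  | succ m ih => rw [Computability.unaryEncodeNat, ih, List.replicate_succ]

theorem initList_machine (m : ℕ) :
    Turing.initList (machine pre X mid Y post) (List.replicate m true) =
      cfg pre X mid Y post (some .next) false m 0 [] := by
  unfold Turing.initList cfg
  congr 1
  funext k
  cases k <;> rfl

theorem haltList_machine (o : List VecSymbol) :
    Turing.haltList (machine pre X mid Y post) o = cfg pre X mid Y post none false 0 0 o := by
  unfold Turing.haltList cfg
  congr 1
  funext k
  cases k <;> rfl

end WordPrinter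

/-- The vectors are segments of one sequence, so the output is the concatenation of the words for `k
< m`, which is what the printing machine leaves on its output stack. -/
theorem VectorFamily.isFP_of_encodeRat_eq (pre X mid Y post : List VecSymbol) (c : ℕ → ℚ)
    (h : ∀ k, encodeRat (c k) ++ [VecSymbol.comma] = WordPrinter.word pre X mid Y post k) :
    VectorFamily.IsFP fun _ i => c i := by
  refine ⟨{ tm := WordPrinter.machine pre X mid Y post
            inputAlphabet := Equiv.refl Bool
            outputAlphabet := Equiv.refl VecSymbol
            time := (Polynomial.X + 1) ^ 2
            outputsFun := fun m => { steps := (m + 1) ^ 2, evals_in_steps := ?_, steps_le_m := ?_ } }⟩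
  · have hout : encodeRatList (List.ofFn fun i : Fin m => c i) =
        (List.range m).flatMap (WordPrinter.word pre X mid Y post) := by
      rw [← funext h, List.ofFn_eq_map, encodeRatList, List.flatMap_map,
        ← List.map_coe_finRange_eq_range, List.flatMap_map]
    have hrun := WordPrinter.run_all pre X mid Y post m false []
    rw [List.append_nil, ← hout, ← WordPrinter.initList_machine,
      ← WordPrinter.haltList_machine] at hrun
    have hin : List.map (Equiv.refl Bool).invFun (Computability.unaryEncodeNat m) =
        List.replicate m true := by
      rw [WordPrinter.unaryEncodeNat_eq_replicate]
      exact List.map_id _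
    have hid : ∀ l : List VecSymbol, List.map (Equiv.refl VecSymbol).invFun l = l :=
      fun l => List.map_id l
    refine Eq.trans (congrArg (WordPrinter.run pre X mid Y post _)
      (congrArg (Turing.initList (WordPrinter.machine pre X mid Y post)) hin)) (hrun.trans ?_)
    exact congrArg (fun o => some (Turing.haltList (WordPrinter.machine pre X mid Y post) o))
      (hid _).symm
  · simp [WordPrinter.unaryEncodeNat_eq_replicate]

/-! ### Scoring vectors with the same winners -/

/-- The election whose candidates are the elements of `Fin m`. -/
def finElection (m : ℕ) (hm : 1 ≤ m) (votes : List (Equiv.Perm (Fin m))) : Election where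
  numCands := m
  numCands_pos := hm
  Cand := Fin m
  card_cand := Nat.card_fin m
  votes := votes

/-- The score of candidate `c` under the vector `α` when the candidates are named `Fin m`. -/
def finScore {m : ℕ} (votes : List (Equiv.Perm (Fin m))) (α : Fin m → ℚ) (c : Fin m) : ℚ :=
  (votes.map fun v => α (v c)).sum

theorem finScore_append {m : ℕ} (u v : List (Equiv.Perm (Fin m))) (α : Fin m → ℚ) (c : Fin m) :
    finScore (u ++ v) α c = finScore u α c + finScore v α c := by
  simp [finScore]

theorem finScore_replicate {m : ℕ} (n : ℕ) (v : Equiv.Perm (Fin m)) (α : Fin m → ℚ) (c : Fin m) :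
    finScore (List.replicate n v) α c = n * α (v c) := by
  simp [finScore]

/-- Two vectors select the same winners in every election. -/
def SameWinners {m : ℕ} (α β : Fin m → ℚ) : Prop :=
  ∀ votes : List (Equiv.Perm (Fin m)), ∀ c,
    (∀ d, finScore votes α d ≤ finScore votes α c) ↔ ∀ d, finScore votes β d ≤ finScore votes β c

theorem VectorFamily.Generates.sameWinners {f g : VectorFamily} {E : ElectionSystem}
    (hf : f.Generates E) (hg : g.Generates E) {m : ℕ} (hm : 1 ≤ m) :
    SameWinners (f m) (g m) := by
  intro votes c
  have h := (hf (finElection m hm votes)).symm.trans (hg (finElection m hm votes))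
  exact Set.ext_iff.1 h c

/-- In the election with one vote, `0` wins alone under `α`; if `β 0 ≤ β 1`, candidate `1` would win
as well. -/
theorem SameWinners.lt {m : ℕ} {α β : Fin (m + 2) → ℚ} (hα : StrictAnti α)
    (h : SameWinners α β) : β 1 < β 0 := by
  have hs : ∀ (γ : Fin (m + 2) → ℚ) c, finScore [1] γ c = γ c := by simp [finScore]
  have h0 := (h [1] 0).1 fun d => by
    rw [hs, hs]
    exact hα.antitone (Fin.zero_le d)
  by_contra hlt
  have h1 := (h [1] 1).2 fun d => by
    have := h0 d
    rw [hs, hs] at this ⊢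
    exact this.trans (not_lt.1 hlt)
  have := h1 0
  rw [hs, hs] at this
  exact absurd (hα (show (0 : Fin (m + 2)) < 1 from Fin.zero_lt_one)) (not_lt.2 this)

/-- Votes in favour of the candidates `0` and `1` separate them from the other candidates without
affecting the comparison of their own scores. -/
theorem SameWinners.tie {m : ℕ} {α β : Fin (m + 2) → ℚ} (hα : StrictAnti α)
    (h : SameWinners α β) (votes : List (Equiv.Perm (Fin (m + 2))))
    (ht : finScore votes α 0 = finScore votes α 1) :
    finScore votes β 0 = finScore votes β 1 := by
  have h01 : α 1 < α 0 := hα (show (0 : Fin (m + 2)) < 1 from Fin.zero_lt_one)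
  -- Each pair of added votes gives `α 0 + α 1` to both leading candidates but only `2 * α d` to any
  -- other `d`, so enough pairs outweigh every initial deficit.
  obtain ⟨K, hK⟩ : ∃ K : ℕ, ∀ d : Fin (m + 2), d ≠ 0 → d ≠ 1 →
      finScore votes α d + K * (2 * α d) ≤ finScore votes α 0 + K * (α 0 + α 1) := by
    have hd : ∀ d : Fin (m + 2), ∃ K : ℕ, d ≠ 0 → d ≠ 1 → ∀ L : ℕ, K ≤ L →
        finScore votes α d + L * (2 * α d) ≤ finScore votes α 0 + L * (α 0 + α 1) := by
      intro d
      by_cases hd : 1 < d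
      · have hlt := hα hd
        obtain ⟨K, hK⟩ := exists_nat_ge
          ((finScore votes α d - finScore votes α 0) / (α 0 + α 1 - 2 * α d))
        refine ⟨K, fun _ _ L hL => ?_⟩
        have hL' : (K : ℚ) ≤ L := by exact_mod_cast hL
        have := (div_le_iff₀ (by linarith)).1 (hK.trans hL')
        linarith
      · refine ⟨0, fun h0 h1 => absurd (lt_of_le_of_ne ?_ (Ne.symm h1)) hd⟩
        exact Fin.one_le_of_ne_zero h0
    choose K hK using hd
    exact ⟨Finset.univ.sup K, fun d h0 h1 =>
      hK d h0 h1 _ (Finset.le_sup (Finset.mem_univ d))⟩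
  let base : List (Equiv.Perm (Fin (m + 2))) :=
    List.replicate K 1 ++ List.replicate K (Equiv.swap 0 1)
  have hs : ∀ γ d, finScore (votes ++ base) γ d =
      finScore votes γ d + (K * γ d + K * γ (Equiv.swap 0 1 d)) := by
    intro γ d
    simp only [base, finScore_append, finScore_replicate, Equiv.Perm.coe_one, id_eq]
  have hmax : ∀ d, finScore (votes ++ base) α d ≤ finScore (votes ++ base) α 0 := by
    intro d
    rw [hs, hs]
    by_cases h0 : d = 0
    · rw [h0]
    · by_cases h1 : d = 1
      · rw [h1, Equiv.swap_apply_left, Equiv.swap_apply_right, ← ht]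
        linarith
      · rw [Equiv.swap_apply_of_ne_of_ne h0 h1, Equiv.swap_apply_left]
        linarith [hK d h0 h1]
  have heq : finScore (votes ++ base) α 0 = finScore (votes ++ base) α 1 := by
    rw [hs, hs, Equiv.swap_apply_left, Equiv.swap_apply_right, ht]
    ring
  -- Both `0` and `1` win under `α`, hence under `β`, so their `β`-scores agree; the added votes
  -- cancel.
  have h0 := (h _ 0).1 hmax 1
  have h1 := (h _ 1).1 (fun d => heq ▸ hmax d) 0
  have := le_antisymm h1 h0
  rw [hs, hs, Equiv.swap_apply_left, Equiv.swap_apply_right] at this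
  linarith

/-- Since coefficients are rational, every gap ratio of `α` is realised by a tie between two
candidates, and `SameWinners.tie` transfers it to `β`. -/
theorem SameWinners.exists_affine {m : ℕ} {α β : Fin (m + 2) → ℚ} (hα : StrictAnti α)
    (h : SameWinners α β) : ∃ a b : ℚ, 0 < a ∧ ∀ j, β j = a * α j + b := by
  have h01 : 0 < α 0 - α 1 := sub_pos.2 (hα (show (0 : Fin (m + 2)) < 1 from Fin.zero_lt_one))
  have hβ : 0 < β 0 - β 1 := sub_pos.2 (h.lt hα)
  have key : ∀ j, (β 0 - β 1) * (α 0 - α j) = (α 0 - α 1) * (β 0 - β j) := by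
    intro j
    by_cases hj : j = 0
    · simp [hj]
    have hj0 : 0 ≤ α 0 - α j := sub_nonneg.2 (hα.antitone (Fin.zero_le j))
    have hq : 0 ≤ (α 0 - α j) / (α 0 - α 1) := by positivity
    set q : ℚ := (α 0 - α j) / (α 0 - α 1) with hqdef
    have hqα : q * (α 0 - α 1) = α 0 - α j := div_mul_cancel₀ _ h01.ne'
    have hden : (q.den : ℚ) ≠ 0 := by exact_mod_cast q.den_nz
    have hnum : (q.num.toNat : ℚ) = q * q.den := by
      rw [Rat.mul_den_eq_num]
      exact_mod_cast Int.toNat_of_nonneg (Rat.num_nonneg.2 hq)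
    -- The second kind of vote puts `0` at position `j` and `1` at position `0`. The multiplicities,
    -- numerator and denominator of `q`, balance its loss against the gains of the first kind.
    let votes : List (Equiv.Perm (Fin (m + 2))) :=
      List.replicate q.num.toNat 1 ++
        List.replicate q.den ((Equiv.swap 0 1).trans (Equiv.swap 1 j))
    have hs0 : ∀ γ, finScore votes γ 0 = q * q.den * γ 0 + q.den * γ j := by
      intro γ
      simp [votes, finScore_append, finScore_replicate, hnum]
    have hs1 : ∀ γ, finScore votes γ 1 = q * q.den * γ 1 + q.den * γ 0 := by
      intro γ
      simp [votes, finScore_append, finScore_replicate, hnum,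
        Equiv.swap_apply_of_ne_of_ne (show (0 : Fin (m + 2)) ≠ 1 by simp) (Ne.symm hj)]
    have ht := h.tie hα votes (by
      rw [hs0, hs1]
      linear_combination (q.den : ℚ) * hqα)
    rw [hs0, hs1] at ht
    have hqβ : q * (β 0 - β 1) = β 0 - β j := by
      apply mul_left_cancel₀ hden
      linear_combination ht
    rw [← hqα, ← hqβ]
    ring
  refine ⟨(β 0 - β 1) / (α 0 - α 1), β 0 - (β 0 - β 1) / (α 0 - α 1) * α 0, by positivity, ?_⟩
  intro j
  have := key j
  field_simp
  linarith

/-! ### Rigidity of pure generators -/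

/-- If the gaps of `c` are not geometric at the start, then every pure generator of the system
generated by the initial segments of `c` consists of the initial segments of an affine image of
`c`. -/
theorem VectorFamily.exists_affine_of_generates {c : ℕ → ℚ} (hc : StrictAnti c)
    (hshift : (c 1 - c 2) * (c 1 - c 2) ≠ (c 0 - c 1) * (c 2 - c 3))
    (hskip : (c 0 - c 2) * (c 1 - c 2) ≠ (c 0 - c 1) * (c 2 - c 3))
    {E : ElectionSystem} (hE : VectorFamily.Generates (fun _ i => c i) E)
    {T : Set ℚ} {g : VectorFamily} (hT : g.IsScoring T) (hpure : g.IsPure) (hg : g.Generates E) :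
    ∃ a b : ℚ, 0 < a ∧ ∀ k, a * c k + b ∈ T := by
  -- Lengths start at 3 so that the shorter vector always has the components 0, 1, 2 compared below.
  have haff : ∀ n : ℕ, ∃ a b : ℚ, 0 < a ∧ ∀ j : Fin (n + 3), g (n + 3) j = a * c j + b := by
    intro n
    exact SameWinners.exists_affine (m := n + 1) (fun i j hij => hc hij)
      (hE.sameWinners hg (by omega : 1 ≤ n + 3))
  choose a b ha hab using haff
  have hstep : ∀ n, a (n + 1) = a n ∧ b (n + 1) = b n := by
    intro n
    obtain ⟨i, hi⟩ := hpure (n + 3) (by omega)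
    have hi' : ∀ j : ℕ, j < n + 3 →
        a (n + 1) * c (if j < i then j else j + 1) + b (n + 1) = a n * c j + b n := by
      intro j hj
      have hval : ((i.succAbove ⟨j, hj⟩ : Fin (n + 3 + 1)) : ℕ) =
          if j < (i : ℕ) then j else j + 1 := by
        simp only [Fin.succAbove, Fin.lt_def]
        split_ifs <;> simp_all
      have h1 := hab (n + 1) (i.succAbove ⟨j, hj⟩)
      have h2 := hab n ⟨j, hj⟩
      rw [hval] at h1
      rw [← h1, ← h2]
      exact hi ⟨j, hj⟩
    have e0 := hi' 0 (by omega)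
    have e1 := hi' 1 (by omega)
    have e2 := hi' 2 (by omega)
    have hpos : a n * a (n + 1) ≠ 0 := (mul_pos (ha _) (ha _)).ne'
    obtain hi0 | hi1 | hi2 : (i : ℕ) = 0 ∨ (i : ℕ) = 1 ∨ 2 ≤ (i : ℕ) := by omega
    -- Deleting component 0 would make the gap pairs (c₀-c₁, c₁-c₂) and (c₁-c₂, c₂-c₃) proportional.
    · simp only [hi0, not_lt_zero, if_false, zero_add, Nat.reduceAdd] at e0 e1 e2
      refine absurd (mul_left_cancel₀ hpos ?_) hshift
      linear_combination a n * (c 1 - c 2) * (e0 - e1) - a n * (c 0 - c 1) * (e1 - e2)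
    -- Deleting component 1 would make (c₀-c₁, c₁-c₂) and (c₀-c₂, c₂-c₃) proportional.
    · simp only [hi1, zero_lt_one, if_true, lt_irrefl, if_false, Nat.reduceAdd,
        show ¬ (2 < 1) by norm_num] at e0 e1 e2
      refine absurd (mul_left_cancel₀ hpos ?_) hskip
      linear_combination a n * (c 1 - c 2) * (e0 - e1) - a n * (c 0 - c 1) * (e1 - e2)
    -- Components 0 and 1 survive, and two distinct values determine an affine map.
    · rw [if_pos (by omega)] at e0 e1
      have h01 : c 0 - c 1 ≠ 0 := (sub_pos.2 (hc zero_lt_one)).ne'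
      have hA : a (n + 1) = a n := by
        apply mul_right_cancel₀ h01
        linear_combination e0 - e1
      rw [hA] at e0
      exact ⟨hA, by linarith⟩
  have hconst : ∀ n, a n = a 0 ∧ b n = b 0 := by
    intro n
    induction n with
    | zero => exact ⟨rfl, rfl⟩
    | succ n ih => exact ⟨(hstep n).1.trans ih.1, (hstep n).2.trans ih.2⟩
  refine ⟨a 0, b 0, ha 0, fun k => ?_⟩
  have h := (hT (k + 3) (by omega)).2 ⟨k, by omega⟩
  rw [hab k, (hconst k).1, (hconst k).2] at h
  exact h

/-! ### Systems generated by initial segments, and obstructions to coefficients in `T` -/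

theorem VectorFamily.isPure_initialSegments (c : ℕ → ℚ) :
    VectorFamily.IsPure fun _ i => c i := by
  intro m _
  exact ⟨Fin.last m, fun j => by simp⟩

/-- The election system generated by the initial segments of `c`. -/
def segmentSystem (c : ℕ → ℚ) : ElectionSystem :=
  fun e => e.scoringWinners fun i => c i

theorem segmentSystem_mem_uniformPSR {c : ℕ → ℚ} (hc : Antitone c) {T : Set ℚ}
    (hT : ∀ k, c k ∈ T) (hFP : VectorFamily.IsFP fun _ i => c i) :
    segmentSystem c ∈ uniformPSR T :=
  ⟨fun _ i => c i, hFP, fun _ _ => ⟨fun _ _ hij => hc hij, fun i => hT i⟩,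
    VectorFamily.isPure_initialSegments c, fun _ => rfl⟩

theorem segmentSystem_notMem_nonuniformPSR {c : ℕ → ℚ} (hc : StrictAnti c)
    (hshift : (c 1 - c 2) * (c 1 - c 2) ≠ (c 0 - c 1) * (c 2 - c 3))
    (hskip : (c 0 - c 2) * (c 1 - c 2) ≠ (c 0 - c 1) * (c 2 - c 3)) {T : Set ℚ}
    (hT : ∀ a b : ℚ, 0 < a → ∃ k, a * c k + b ∉ T) :
    segmentSystem c ∉ nonuniformPSR T := by
  rintro ⟨g, hg, hpure, hgen⟩
  obtain ⟨a, b, ha, hab⟩ := VectorFamily.exists_affine_of_generates hc hshift hskip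
    (E := segmentSystem c) (fun _ => rfl) hg hpure hgen
  obtain ⟨k, hk⟩ := hT a b ha
  exact hk (hab k)

theorem exists_affine_notMem_nonnegRatCoeffs {c : ℕ → ℚ} (hc : ∀ k : ℕ, c k ≤ -k) (a b : ℚ)
    (ha : 0 < a) : ∃ k, a * c k + b ∉ nonnegRatCoeffs := by
  obtain ⟨k, hk⟩ := exists_nat_gt (b / a)
  refine ⟨k, fun h => ?_⟩
  have h' : 0 ≤ a * c k + b := h
  rw [div_lt_iff₀ ha] at hk
  nlinarith [mul_le_mul_of_nonneg_left (hc k) ha.le]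

/-- The multiples stay positive but eventually drop below 1. -/
theorem exists_two_pow_inv_notMem_intCoeffs {a : ℚ} (ha : 0 < a) :
    ∃ k : ℕ, a * (1 / 2) ^ k ∉ intCoeffs := by
  obtain ⟨k, hk⟩ := exists_pow_lt_of_lt_one (show (0 : ℚ) < 1 / a by positivity)
    (show (1 / 2 : ℚ) < 1 by norm_num)
  refine ⟨k, ?_⟩
  rintro ⟨z, hz⟩
  rw [lt_div_iff₀ ha, mul_comm, ← hz] at hk
  have hpos : (0 : ℚ) < z := hz ▸ by positivity
  have h1 : z < 1 := by exact_mod_cast hk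
  have h0 : 0 < z := by exact_mod_cast hpos
  omega

theorem intCoeffs_sub {p q : ℚ} (hp : p ∈ intCoeffs) (hq : q ∈ intCoeffs) : p - q ∈ intCoeffs := by
  obtain ⟨x, rfl⟩ := hp
  obtain ⟨y, rfl⟩ := hq
  exact ⟨x - y, by push_cast; rfl⟩

theorem intCoeffs_intCast_mul (z : ℤ) {p : ℚ} (hp : p ∈ intCoeffs) : z * p ∈ intCoeffs := by
  obtain ⟨x, rfl⟩ := hp
  exact ⟨z * x, by push_cast; rfl⟩

/-! ### The three separating sequences -/

/-- A bounded sequence of positive rationals with unbounded denominators. -/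
def fracSeq (k : ℕ) : ℚ := ((2 * (2 ^ k) + 1 : ℕ) : ℚ) / ((4 ^ k : ℕ) : ℚ)

/-- A sequence of integers tending to `-∞`. -/
def intSeq (k : ℕ) : ℚ := -(((2 ^ k * (2 * 2 ^ k + 1) : ℕ) : ℚ) / ((1 : ℕ) : ℚ))

/-- A sequence of rationals tending to `-∞` with unbounded denominators. -/
def mixedSeq (k : ℕ) : ℚ := -(((2 * (4 ^ k) + 1 : ℕ) : ℚ) / ((2 ^ k : ℕ) : ℚ))

theorem fracSeq_eq (k : ℕ) : fracSeq k = 2 * (1 / 2) ^ k + (1 / 4) ^ k := by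
  have h4 : (4 : ℚ) ^ k = 2 ^ k * 2 ^ k := by rw [← mul_pow]; norm_num
  simp only [fracSeq, one_div, inv_pow]
  push_cast
  rw [h4]
  field_simp

theorem intSeq_eq (k : ℕ) : intSeq k = -(2 ^ k + 2 * 4 ^ k) := by
  have h4 : (4 : ℚ) ^ k = 2 ^ k * 2 ^ k := by rw [← mul_pow]; norm_num
  simp only [intSeq]
  push_cast
  rw [h4]
  ring

theorem mixedSeq_eq (k : ℕ) : mixedSeq k = -((1 / 2) ^ k + 2 * 2 ^ k) := by
  have h4 : (4 : ℚ) ^ k = 2 ^ k * 2 ^ k := by rw [← mul_pow]; norm_num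
  simp only [mixedSeq, one_div, inv_pow]
  push_cast
  rw [h4]
  field_simp
  ring

theorem fracSeq_strictAnti : StrictAnti fracSeq := by
  refine strictAnti_nat_of_succ_lt fun k => ?_
  rw [fracSeq_eq, fracSeq_eq, pow_succ, pow_succ]
  have h1 : (0 : ℚ) < (1 / 2) ^ k := by positivity
  have h2 : (0 : ℚ) < (1 / 4) ^ k := by positivity
  linarith

theorem intSeq_strictAnti : StrictAnti intSeq := by
  refine strictAnti_nat_of_succ_lt fun k => ?_
  rw [intSeq_eq, intSeq_eq, pow_succ, pow_succ]
  have h1 : (0 : ℚ) < 2 ^ k := by positivity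
  have h2 : (0 : ℚ) < 4 ^ k := by positivity
  linarith

theorem mixedSeq_strictAnti : StrictAnti mixedSeq := by
  refine strictAnti_nat_of_succ_lt fun k => ?_
  rw [mixedSeq_eq, mixedSeq_eq, pow_succ, pow_succ]
  have h1 : (1 / 2 : ℚ) ^ k ≤ 1 := pow_le_one₀ (by norm_num) (by norm_num)
  have h2 : (1 : ℚ) ≤ 2 ^ k := one_le_pow₀ (by norm_num)
  linarith

/-- An odd numerator over a power of two is already reduced. With the least significant bit first,
the word is 1 0ᵏ 1 / (00)ᵏ 1 and a comma. -/
theorem fracSeq_isFP : VectorFamily.IsFP fun _ i => fracSeq i := by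
  refine VectorFamily.isFP_of_encodeRat_eq [.bit true] [.bit false] [.bit true, .slash]
    [.bit false, .bit false] [.bit true, .comma] _ fun k => ?_
  have hcop : (2 * 2 ^ k + 1).Coprime (4 ^ k) := by
    rw [show 4 ^ k = 2 ^ (2 * k) by rw [pow_mul]; norm_num]
    exact Nat.Coprime.pow_right _ (by simp)
  rw [fracSeq, encodeRat_natCast_div (by positivity) hcop, encodeNatBits_two_mul_add_one]
  simp [encodeNatBits_two_pow, encodeNatBits_four_pow, WordPrinter.word]

theorem intSeq_isFP : VectorFamily.IsFP fun _ i => intSeq i := by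
  refine VectorFamily.isFP_of_encodeRat_eq [.minus] [.bit false] [.bit true] [.bit false]
    [.bit true, .slash, .bit true, .comma] _ fun k => ?_
  rw [intSeq, encodeRat_neg_natCast_div (by positivity) one_ne_zero (Nat.coprime_one_right _),
    encodeNatBits_two_pow_mul k (by positivity), encodeNatBits_two_mul_add_one,
    encodeNatBits_two_pow, show encodeNatBits 1 = [.bit true] from encodeNatBits_two_pow 0]
  simp [WordPrinter.word]

theorem mixedSeq_isFP : VectorFamily.IsFP fun _ i => mixedSeq i := by
  refine VectorFamily.isFP_of_encodeRat_eq [.minus, .bit true] [.bit false, .bit false]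
    [.bit true, .slash] [.bit false] [.bit true, .comma] _ fun k => ?_
  have hcop : (2 * 4 ^ k + 1).Coprime (2 ^ k) := Nat.Coprime.pow_right k (by simp)
  rw [mixedSeq, encodeRat_neg_natCast_div (by positivity) (by positivity) hcop,
    encodeNatBits_two_mul_add_one]
  simp [encodeNatBits_two_pow, encodeNatBits_four_pow, WordPrinter.word]

theorem exists_affine_fracSeq_notMem_intCoeffs (a b : ℚ) (ha : 0 < a) :
    ∃ k, a * fracSeq k + b ∉ intCoeffs := by
  by_contra! h
  obtain ⟨k, hk⟩ := exists_two_pow_inv_notMem_intCoeffs ha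
  refine hk ?_
  have hgap : ∀ k, a * fracSeq k + b - (a * fracSeq (k + 1) + b) ∈ intCoeffs :=
    fun k => intCoeffs_sub (h k) (h (k + 1))
  -- The factor 4 cancels the 4⁻ᵏ part of the gaps and leaves exactly `a * (1 / 2) ^ k`.
  convert intCoeffs_sub (intCoeffs_intCast_mul 4 (hgap (k + 1))) (hgap k) using 1
  simp only [fracSeq_eq, pow_succ]
  push_cast
  ring

theorem exists_affine_mixedSeq_notMem_intCoeffs (a b : ℚ) (ha : 0 < a) :
    ∃ k, a * mixedSeq k + b ∉ intCoeffs := by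
  by_contra! h
  obtain ⟨k, hk⟩ := exists_two_pow_inv_notMem_intCoeffs (show 0 < 3 / 4 * a by positivity)
  refine hk ?_
  have hgap : ∀ k, a * mixedSeq k + b - (a * mixedSeq (k + 1) + b) ∈ intCoeffs :=
    fun k => intCoeffs_sub (h k) (h (k + 1))
  -- The factor 2 cancels the 2ᵏ part of the gaps; what remains is `3 / 4 * a * (1 / 2) ^ k`.
  convert intCoeffs_sub (hgap (k + 1)) (intCoeffs_intCast_mul 2 (hgap k)) using 1
  simp only [mixedSeq_eq, pow_succ]
  push_cast
  ring

theorem natCast_le_two_pow (k : ℕ) : (k : ℚ) ≤ 2 ^ k := by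
  exact_mod_cast Nat.lt_two_pow_self.le

theorem intSeq_le (k : ℕ) : intSeq k ≤ -k := by
  rw [intSeq_eq]
  have h4 : (0 : ℚ) < 4 ^ k := by positivity
  linarith [natCast_le_two_pow k]

theorem mixedSeq_le (k : ℕ) : mixedSeq k ≤ -k := by
  rw [mixedSeq_eq]
  have h1 : (0 : ℚ) < (1 / 2) ^ k := by positivity
  have h2 : (0 : ℚ) < 2 ^ k := by positivity
  linarith [natCast_le_two_pow k]

/-! ### The three separations -/

theorem segmentSystem_fracSeq_notMem :
    segmentSystem fracSeq ∉ nonuniformPSR intCoeffs := by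
  refine segmentSystem_notMem_nonuniformPSR fracSeq_strictAnti ?_ ?_
    exists_affine_fracSeq_notMem_intCoeffs
  all_goals
    simp only [fracSeq_eq]
    norm_num

theorem segmentSystem_intSeq_notMem :
    segmentSystem intSeq ∉ nonuniformPSR nonnegRatCoeffs := by
  refine segmentSystem_notMem_nonuniformPSR intSeq_strictAnti ?_ ?_
    (exists_affine_notMem_nonnegRatCoeffs intSeq_le)
  all_goals
    simp only [intSeq_eq]
    norm_num

theorem segmentSystem_mixedSeq_notMem {T : Set ℚ}
    (hT : ∀ a b : ℚ, 0 < a → ∃ k, a * mixedSeq k + b ∉ T) :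
    segmentSystem mixedSeq ∉ nonuniformPSR T := by
  refine segmentSystem_notMem_nonuniformPSR mixedSeq_strictAnti ?_ ?_ hT
  all_goals
    simp only [mixedSeq_eq]
    norm_num

theorem mainTheorem3 :
    ¬ uniformPSR nonnegRatCoeffs ⊆ nonuniformPSR intCoeffs ∧
    ¬ uniformPSR intCoeffs ⊆ nonuniformPSR nonnegRatCoeffs ∧
    ¬ uniformPSR ratCoeffs ⊆ nonuniformPSR nonnegRatCoeffs ∪ nonuniformPSR intCoeffs := by
  refine ⟨fun h => ?_, fun h => ?_, fun h => ?_⟩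
  · refine segmentSystem_fracSeq_notMem (h (segmentSystem_mem_uniformPSR
      fracSeq_strictAnti.antitone (fun k => ?_) fracSeq_isFP))
    show 0 ≤ fracSeq k
    rw [fracSeq]
    positivity
  · refine segmentSystem_intSeq_notMem (h (segmentSystem_mem_uniformPSR
      intSeq_strictAnti.antitone (fun k => ?_) intSeq_isFP))
    refine ⟨-(2 ^ k + 2 * 4 ^ k), ?_⟩
    rw [intSeq_eq]
    push_cast
    rfl
  · obtain h' | h' := h (segmentSystem_mem_uniformPSR mixedSeq_strictAnti.antitone
      (fun _ => Set.mem_univ _) mixedSeq_isFP)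
    · exact segmentSystem_mixedSeq_notMem (exists_affine_notMem_nonnegRatCoeffs mixedSeq_le) h'
    · exact segmentSystem_mixedSeq_notMem exists_affine_mixedSeq_notMem_intCoeffs h'
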